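/- **Theorem** (of constructive mathematics, stated as validity in the internal logic of every Grothendieck topos). *Let $P : \mathbb N \to \mathsf{Prop}$ be a family of semidecidable propositions. Then $\forall n.\, P_n$ is $\omega^2$-decidable.* *Notions.* $\mathsf{Brw}$ is the set of Brouwer ordinals, the quotient inductive-inductive type generated, simultaneously with its order $\le$, by $0$, successors $x \mapsto x+1$, and limits $\lim f$ of strictly increasing sequences $f : \mathbb N \to \mathsf{Brw}$ (i.e. $f_n + 1 \le f_{n+1}$ for all $n$), where $0$ is minimal, successor is monotone, $\lim f$ is the least upper bound of $f$, $\le$ is transitive, and $x = y$ whenever $x \le y$ and $y \le x$. Put $\omega\cdot 0 = 0$, $\omega\cdot(n+1) = \lim_k(\omega\cdot n + k)$ and $\omega^2 = \lim_n (\omega\cdot n)$. A proposition $Q$ is *semidecidable* if there (merely) exists $s : \mathbb N \to \{0,1\}$ with $Q \leftrightarrow \exists i.\, s_i = 1$. It is *$\alpha$-decidable*, for $\alpha : \mathsf{Brw}$, if there (merely) exists $y : \mathsf{Brw}$ with $Q \leftrightarrow \alpha \le y$. Neither excluded middle nor countable choice is available. *Explicitly.* Let $(C,J)$ be any site and $U$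 an object of $C$. Propositions at stage $U$ are the $J$-closed sieves on $U$. A Boolean at stage $V$ is a pair of disjoint closed sieves $(b_0,b_1)$ on $V$ that jointly cover $V$, where disjoint means that any stage belonging to both sieves is covered by the empty sieve. $\mathsf{Brw}(V)$ is the set of sections over $V$ of the sheaf interpreting $\mathsf{Brw}$: terms built from $0$, successors, limits of strictly increasing sequences of terms over the same object, and amalgamations of matching families of terms over covering sieves, identified when each is $\le$ the other; here $\le$ is generated by the rules above and the rule that a relation between an amalgamation and another term holds if it holds locally for the pieces. Let $(P_n)_{n\in\mathbb N}$ be closed sieves on $U$ such that for every $n$ there is a cover of $U$ over each member $f : V \to U$ of which there is a sequence $(s_i)_{i\in\mathbb N}$ of Booleans at stage $V$ with the property that, for all $g : W \to V$, one has $f\circ g \in P_n$ if and only if $W$ is covered by maps $h$ such that, for some $i$, $s_i$ has the value $1$ at the stage $g \circ h$. Then there is a cover of $U$ over each member $f : V \to U$ of which there is $y \in \mathsf{Brw}(V)$ such that, for all $g : W \to V$, $$ f\circ g \in \bigcap_n P_n \iff \omega^2 \le y|_g \ \text{ in } \mathsf{Brw}(W). $$ -/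

import Mathlib

/-!
Ordinal decidability, interpreted in the sheaf semantics of constructive mathematics.

Read in Lean's classical logic, "`P` is `α`-decidable" would hold for every `P` and every `α > 0`.
The notions below are therefore the interpretations of the constructive notions in the internal
logic (Kripke-Joyal forcing) of the topos of sheaves on an arbitrary site `(C, J)`, where neither
excluded middle nor countable choice is available.  A predicate about an object `U` of the site
says that the constructive statement in question is forced at the stage `U`.  For the one-point
site, forcing is ordinary truth.
-/

open CategoryTheory

universe v u

namespace OrdDec

variable {C : Type u} [Category.{v} C]

section TruthValues

/-- The type `Prop` of propositions at stage `U`: the `J`-closed sieves on `U`, that is, the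
sections over `U` of the subobject classifier of the topos of sheaves.  The proposition `P` is
forced at a later stage `f : V ⟶ U` iff `P.1 f`. -/
def Truth (J : GrothendieckTopology C) (U : C) : Type (max u v) :=
  {S : Sieve U // J.IsClosed S}

/-- The proposition `∀ n : ℕ, P n` at stage `U`: it is forced at `f` iff all `P n` are. -/
def Truth.forallNat {J : GrothendieckTopology C} {U : C} (P : ℕ → Truth J U) : Truth J U :=
  ⟨{ arrows := fun _ f => ∀ n, (P n).1 f
     downward_closed := fun h g n => (P n).1.downward_closed (h n) g },
   fun _ f hf n => (P n).2 f (J.superset_covering (by intro W g hg; exact hg n) hf)⟩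

/-- A section over `U` of the sheaf `𝟐 = 1 + 1` of Booleans, i.e. a function on `U` that is
locally `true` or `false`: two disjoint closed sieves on `U` (`holds b` are the stages at which the
value is `b`) that jointly cover `U`. -/
structure BoolSection (J : GrothendieckTopology C) (U : C) : Type (max u v) where
  holds : Bool → Sieve U
  closed : ∀ b, J.IsClosed (holds b)
  disjoint : ∀ ⦃V : C⦄ (f : V ⟶ U), holds true f → holds false f → (⊥ : Sieve V) ∈ J V
  covers : holds true ⊔ holds false ∈ J U

/-- `U` forces `∃ i, s i = 1`: locally there is an index `i` at which the value of `s` is `1`. -/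
def ExistsTrue {J : GrothendieckTopology C} {U V : C} (s : ℕ → BoolSection J U) (f : V ⟶ U) :
    Prop :=
  ∃ R ∈ J V, ∀ ⦃W : C⦄ (g : W ⟶ V), R g → ∃ i, ((s i).holds true) (g ≫ f)

/-- `U` forces that `P` is semidecidable, i.e. `∃ s : ℕ → 𝟐, (P ↔ ∃ i, s i = 1)`.
The outer (truncated) existential quantifier is interpreted as local existence. -/
def IsSemidecidable {J : GrothendieckTopology C} {U : C} (P : Truth J U) : Prop :=
  ∃ R ∈ J U, ∀ ⦃V : C⦄ (f : V ⟶ U), R f →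
    ∃ s : ℕ → BoolSection J V, ∀ ⦃W : C⦄ (g : W ⟶ V), P.1 (g ≫ f) ↔ ExistsTrue s g

end TruthValues

section Trees

/-- Raw terms for sections of the sheaf of Brouwer ordinals over an object of the site: zero,
successors, limits of sequences, and amalgamations of locally given sections. -/
inductive Tree (J : GrothendieckTopology C) : C → Type (max u v)
  | zero {U : C} : Tree J U
  | suc {U : C} (x : Tree J U) : Tree J U
  | lim {U : C} (f : ℕ → Tree J U) : Tree J U
  | glue {U : C} (R : Sieve U) (hR : R ∈ J U)
      (t : ∀ ⦃V : C⦄ (f : V ⟶ U), R f → Tree J V) : Tree J U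

variable {J : GrothendieckTopology C}

/-- Restriction of a section over `U` along `g : V ⟶ U`. -/
def Tree.restrict : ∀ {U : C}, Tree J U → ∀ {V : C}, (V ⟶ U) → Tree J V
  | _, .zero, _, _ => .zero
  | _, .suc x, _, g => .suc (x.restrict g)
  | _, .lim f, _, g => .lim fun n => (f n).restrict g
  | _, .glue R hR t, _, g =>
      .glue (R.pullback g) (J.pullback_stable g hR) fun _ f hf => t (f ≫ g) hf

mutual

/-- Well-formed terms: limits are taken of strictly increasing sequences only, and amalgamations of
matching families only. -/
inductive Wf {J : GrothendieckTopology C} : ∀ {U : C}, Tree J U → Prop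
  | zero {U : C} : Wf (Tree.zero : Tree J U)
  | suc {U : C} {x : Tree J U} : Wf x → Wf (.suc x)
  | lim {U : C} {f : ℕ → Tree J U} :
      (∀ n, Wf (f n)) → (∀ n, Le (.suc (f n)) (f (n + 1))) → Wf (.lim f)
  | glue {U : C} {R : Sieve U} {hR : R ∈ J U} {t : ∀ ⦃V : C⦄ (f : V ⟶ U), R f → Tree J V} :
      (∀ ⦃V : C⦄ (f : V ⟶ U) (hf : R f), Wf (t f hf)) →
      (∀ ⦃V W : C⦄ (f : V ⟶ U) (hf : R f) (g : W ⟶ V) (k : W ⟶ U) (hk : R k), g ≫ f = k →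
        Le ((t f hf).restrict g) (t k hk)) →
      (∀ ⦃V W : C⦄ (f : V ⟶ U) (hf : R f) (g : W ⟶ V) (k : W ⟶ U) (hk : R k), g ≫ f = k →
        Le (t k hk) ((t f hf).restrict g)) →
      Wf (.glue R hR t)

/-- The order on well-formed terms, generated simultaneously with them: `zero` is minimal, `suc` is
monotone, `lim f` is the least upper bound of `f`, the order is transitive, and the order relations
of an amalgamation are those that hold locally for its pieces. -/
inductive Le {J : GrothendieckTopology C} : ∀ {U : C}, Tree J U → Tree J U → Prop
  | zero {U : C} {x : Tree J U} : Wf x → Le .zero x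
  | trans {U : C} {x y z : Tree J U} : Le x y → Le y z → Le x z
  | suc_mono {U : C} {x y : Tree J U} : Le x y → Le (.suc x) (.suc y)
  | cocone {U : C} {f : ℕ → Tree J U} {x : Tree J U} (k : ℕ) :
      Wf (.lim f) → Le x (f k) → Le x (.lim f)
  | limiting {U : C} {f : ℕ → Tree J U} {x : Tree J U} :
      Wf (.lim f) → (∀ k, Le (f k) x) → Le (.lim f) x
  | glue_le {U : C} {R : Sieve U} {hR : R ∈ J U} {t : ∀ ⦃V : C⦄ (f : V ⟶ U), R f → Tree J V}
      {x : Tree J U} : Wf (.glue R hR t) → Wf x →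
      (∀ ⦃V : C⦄ (f : V ⟶ U) (hf : R f), Le (t f hf) (x.restrict f)) → Le (.glue R hR t) x
  | le_glue {U : C} {R : Sieve U} {hR : R ∈ J U} {t : ∀ ⦃V : C⦄ (f : V ⟶ U), R f → Tree J V}
      {x : Tree J U} : Wf (.glue R hR t) → Wf x →
      (∀ ⦃V : C⦄ (f : V ⟶ U) (hf : R f), Le (x.restrict f) (t f hf)) → Le x (.glue R hR t)

end

theorem Tree.glue_congr {U : C} {R R' : Sieve U} {hR : R ∈ J U} {hR' : R' ∈ J U}
    {t : ∀ ⦃V : C⦄ (f : V ⟶ U), R f → Tree J V} {t' : ∀ ⦃V : C⦄ (f : V ⟶ U), R' f → Tree J V}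
    (h : R = R') (ht : ∀ ⦃V : C⦄ (f : V ⟶ U) (hf : R f) (hf' : R' f), t f hf = t' f hf') :
    Tree.glue R hR t = Tree.glue R' hR' t' := by
  subst h
  congr 1
  funext V f hf
  exact ht f hf hf

theorem Tree.piece_congr {U V : C} {R : Sieve U} (t : ∀ ⦃V : C⦄ (f : V ⟶ U), R f → Tree J V)
    {f f' : V ⟶ U} (h : f = f') (hf : R f) (hf' : R f') : t f hf = t f' hf' := by
  subst h
  rfl

theorem Tree.restrict_id {U : C} (x : Tree J U) : x.restrict (𝟙 U) = x := by
  induction x with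
  | zero => rfl
  | suc x ih => simp [Tree.restrict, ih]
  | lim f ih => simp [Tree.restrict, ih]
  | glue R hR t _ =>
    exact Tree.glue_congr (Sieve.pullback_id) fun V f hf hf' =>
      Tree.piece_congr t (Category.comp_id f) _ _

theorem Tree.restrict_comp {U V W : C} (x : Tree J U) (g : V ⟶ U) (h : W ⟶ V) :
    (x.restrict g).restrict h = x.restrict (h ≫ g) := by
  induction x generalizing V W with
  | zero => rfl
  | suc x ih => simp [Tree.restrict, ih]
  | lim f ih => simp [Tree.restrict, ih]
  | glue R hR t _ =>
    exact Tree.glue_congr (Sieve.pullback_comp R).symm fun V f hf hf' =>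
      Tree.piece_congr t (Category.assoc f h g) _ _

mutual

theorem Wf.restrict : ∀ {U : C} {x : Tree J U}, Wf x → ∀ {V : C} (g : V ⟶ U), Wf (x.restrict g)
  | _, _, .zero, _, _ => .zero
  | _, _, .suc h, _, g => .suc (Wf.restrict h g)
  | _, _, .lim h h', _, g => .lim (fun n => Wf.restrict (h n) g) fun n => Le.restrict (h' n) g
  | _, _, .glue h h₁ h₂, _, g =>
    .glue (fun _ _ hf => h _ hf)
      (fun _ _ f hf k l hl e => h₁ (f ≫ g) hf k (l ≫ g) hl (by rw [← e, Category.assoc]))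
      (fun _ _ f hf k l hl e => h₂ (f ≫ g) hf k (l ≫ g) hl (by rw [← e, Category.assoc]))

theorem Le.restrict : ∀ {U : C} {x y : Tree J U}, Le x y → ∀ {V : C} (g : V ⟶ U),
    Le (x.restrict g) (y.restrict g)
  | _, _, _, .zero hx, _, g => .zero (Wf.restrict hx g)
  | _, _, _, .trans h h', _, g => .trans (Le.restrict h g) (Le.restrict h' g)
  | _, _, _, .suc_mono h, _, g => .suc_mono (Le.restrict h g)
  | _, _, _, .cocone k hf h, _, g => .cocone k (Wf.restrict hf g) (Le.restrict h g)
  | _, _, _, .limiting hf h, _, g =>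
    .limiting (Wf.restrict hf g) fun k => Le.restrict (h k) g
  | _, _, _, .glue_le hw hx h, _, g =>
    .glue_le (Wf.restrict hw g) (Wf.restrict hx g) fun _ f hf =>
      (Tree.restrict_comp _ g f).symm ▸ h (f ≫ g) hf
  | _, _, _, .le_glue hw hx h, _, g =>
    .le_glue (Wf.restrict hw g) (Wf.restrict hx g) fun _ f hf =>
      (Tree.restrict_comp _ g f).symm ▸ h (f ≫ g) hf

end

theorem Le.refl {U : C} {x : Tree J U} (hx : Wf x) : Le x x := by
  induction x with
  | zero => exact .zero hx
  | suc x ih =>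
    cases hx with
    | suc h => exact .suc_mono (ih h)
  | lim f ih =>
    have hx' := hx
    cases hx with
    | lim h _ => exact .limiting hx' fun k => .cocone k hx' (ih k (h k))
  | glue R hR t ih =>
    have hx' := hx
    cases hx with
    | glue h h₁ h₂ =>
      refine .glue_le hx' hx' fun V f hf => .le_glue (Wf.restrict hx' f) (h f hf) ?_
      intro W g hg
      exact h₁ f hf g (g ≫ f) hg rfl

end Trees

section Brouwer

/-- Two terms denote the same ordinal iff each is below the other. -/
instance treeSetoid (J : GrothendieckTopology C) (U : C) : Setoid {x : Tree J U // Wf x} where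
  r x y := Le x.1 y.1 ∧ Le y.1 x.1
  iseqv :=
    { refl := fun x => ⟨.refl x.2, .refl x.2⟩
      symm := fun h => ⟨h.2, h.1⟩
      trans := fun h h' => ⟨.trans h.1 h'.1, .trans h'.2 h.2⟩ }

/-- The sections over `U` of the sheaf of Brouwer ordinals.  This sheaf is the interpretation in
the topos of sheaves of the quotient inductive-inductive type of Brouwer ordinals. -/
def Brw (J : GrothendieckTopology C) (U : C) : Type (max u v) :=
  Quotient (treeSetoid J U)

variable {J : GrothendieckTopology C}

/-- The order of the Brouwer ordinals at stage `U`. -/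
instance (U : C) : PartialOrder (Brw J U) where
  le := Quotient.lift₂ (fun x y => Le x.1 y.1) fun _ _ _ _ h h' =>
    propext ⟨fun e => .trans h.2 (.trans e h'.1), fun e => .trans h.1 (.trans e h'.2)⟩
  le_refl := by rintro ⟨x⟩; exact .refl x.2
  le_trans := by rintro ⟨x⟩ ⟨y⟩ ⟨z⟩ h h'; exact Le.trans h h'
  le_antisymm := by rintro ⟨x⟩ ⟨y⟩ h h'; exact Quotient.sound ⟨h, h'⟩

/-- Restriction of a Brouwer ordinal at stage `U` to a later stage `g : V ⟶ U`. -/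
def Brw.restrict {U V : C} (g : V ⟶ U) : Brw J U → Brw J V :=
  Quotient.map (fun x => ⟨x.1.restrict g, x.2.restrict g⟩) fun _ _ h =>
    ⟨h.1.restrict g, h.2.restrict g⟩

/-- Two sections that agree locally are equal, and every matching family of sections over a cover
has an amalgamation: the sections `Brw J U` do form a sheaf. -/
theorem Brw.existsUnique_amalgamation {U : C} {R : Sieve U} (hR : R ∈ J U)
    (x : ∀ ⦃V : C⦄ (f : V ⟶ U), R f → Brw J V)
    (hx : ∀ ⦃V W : C⦄ (f : V ⟶ U) (hf : R f) (g : W ⟶ V),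
      (x f hf).restrict g = x (g ≫ f) (R.downward_closed hf g)) :
    ∃! y : Brw J U, ∀ ⦃V : C⦄ (f : V ⟶ U) (hf : R f), y.restrict f = x f hf := by
  let t : ∀ ⦃V : C⦄ (f : V ⟶ U), R f → Tree J V := fun V f hf => (x f hf).out.1
  have ht : ∀ ⦃V : C⦄ (f : V ⟶ U) (hf : R f), Wf (t f hf) := fun V f hf => (x f hf).out.2
  have hxt : ∀ ⦃V : C⦄ (f : V ⟶ U) (hf : R f),
      (Quotient.mk _ ⟨t f hf, ht f hf⟩ : Brw J V) = x f hf := fun V f hf => Quotient.out_eq _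
  have hc : ∀ ⦃V W : C⦄ (f : V ⟶ U) (hf : R f) (g : W ⟶ V) (k : W ⟶ U) (hk : R k), g ≫ f = k →
      Le ((t f hf).restrict g) (t k hk) ∧ Le (t k hk) ((t f hf).restrict g) := by
    intro V W f hf g k hk e
    subst e
    have h := hx f hf g
    rw [← hxt f hf, ← hxt (g ≫ f) hk] at h
    exact Quotient.exact h
  have hw : Wf (.glue R hR t) := .glue ht (fun V W f hf g k hk e => (hc f hf g k hk e).1)
    fun V W f hf g k hk e => (hc f hf g k hk e).2
  refine ⟨Quotient.mk _ ⟨_, hw⟩, fun V f hf => ?_, ?_⟩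
  · rw [← hxt f hf]
    refine Quotient.sound ⟨.glue_le (hw.restrict f) (ht f hf) fun W g hg => ?_,
      .le_glue (hw.restrict f) (ht f hf) fun W g hg => ?_⟩
    · exact (hc f hf g _ hg rfl).2
    · exact (hc f hf g _ hg rfl).1
  · rintro ⟨y⟩ hy
    have h : ∀ ⦃V : C⦄ (f : V ⟶ U) (hf : R f),
        Le (y.1.restrict f) (t f hf) ∧ Le (t f hf) (y.1.restrict f) := by
      intro V f hf
      have h := hy f hf
      rw [← hxt f hf] at h
      exact Quotient.exact h
    exact Quotient.sound ⟨.le_glue hw y.2 fun V f hf => (h f hf).1,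
      .glue_le hw y.2 fun V f hf => (h f hf).2⟩

/-- The sum `x + k` of an ordinal and a natural number. -/
def Tree.addNat {U : C} (x : Tree J U) : ℕ → Tree J U
  | 0 => x
  | k + 1 => .suc (x.addNat k)

/-- The ordinal `ω · n`, with `ω · 0 = 0` and `ω · (n + 1) = ω · n + ω = lim (k ↦ ω · n + k)`. -/
def Tree.omegaMul {U : C} : ℕ → Tree J U
  | 0 => .zero
  | n + 1 => .lim fun k => (Tree.omegaMul n).addNat k

theorem Wf.addNat {U : C} {x : Tree J U} (hx : Wf x) (k : ℕ) : Wf (x.addNat k) := by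
  induction k with
  | zero => exact hx
  | succ k ih => exact .suc ih

theorem Wf.omegaMul {U : C} (n : ℕ) : Wf (Tree.omegaMul n : Tree J U) := by
  induction n with
  | zero => exact .zero
  | succ n ih => exact .lim (fun k => ih.addNat k) fun k => .refl (ih.addNat (k + 1))

/-- The ordinal `ω² = ω · ω = lim (n ↦ ω · n)`. -/
def Brw.omegaSq (U : C) : Brw J U :=
  Quotient.mk _ ⟨.lim Tree.omegaMul, .lim Wf.omegaMul fun n =>
    .cocone 1 (Wf.omegaMul (n + 1)) (.refl ((Wf.omegaMul n).addNat 1))⟩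

/-- `U` forces that `P` is `α`-decidable, i.e. `∃ y : Brw, (P ↔ α ≤ y)`.
The (truncated) existential quantifier is interpreted as local existence. -/
def IsOrdinalDecidable {U : C} (α : Brw J U) (P : Truth J U) : Prop :=
  ∃ R ∈ J U, ∀ ⦃V : C⦄ (f : V ⟶ U), R f →
    ∃ y : Brw J V, ∀ ⦃W : C⦄ (g : W ⟶ V),
      P.1 (g ≫ f) ↔ α.restrict (g ≫ f) ≤ y.restrict g

end Brouwer

end OrdDec

/-!
The idea is that `∀ n, P n` should be measured by the ordinal
`z = sup {ω · k + i | i, k : ℕ, P 0, …, P (k - 1)}`.  If all `P n` hold, then `z` is above every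
`ω · k`, hence above `ω²`; conversely, if `ω² ≤ z`, then for every `k` some element of the set whose
supremum is `z` lies above `ω · k`, which forces `P 0, …, P (k - 1)`.

Limits of Brouwer ordinals exist only for strictly increasing sequences, so `z` is obtained as
`lim (n ↦ v n + (n + 1))`, where `v n` is the supremum of the `ω · k + i` with `k ≤ n` only.  Given
Boolean sequences `s j` for the finitely many `P j`, `j < n`, one has `v n = lim (i ↦ ω · c i + i)`,
where `c i` is the largest `k ≤ n` such that each of `s 0, …, s (k - 1)` has taken the value `1` by
the time `i` (`approx`, `isCountSup_lim_approx`).  No choice of the sequences for all `P j` at once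
is available, but none is needed: a supremum is unique, so the locally defined `v n` agree on
overlaps and can be amalgamated (`exists_isCountSup_of_locally`).

For the converse, the order, which is generated by rules including transitivity, has to be
analysed.  To this end `Tree.Lt x n k` defines `ω · n + k < x` by recursion on the term `x`, as
a local notion at each later stage.  It respects the order (`Le.lt_of_lt`), and its defining
equations do the rest (`Tree.Lt.le_of_addNat_omegaMul`).
-/

namespace OrdDec

variable {C : Type u} [Category.{v} C] {J : GrothendieckTopology C}

/-! ### Local truth -/

/-- The predicate `p` holds at all stages of some cover of `U`. -/
def Locally (J : GrothendieckTopology C) {U : C} (p : ∀ ⦃V : C⦄, (V ⟶ U) → Prop) : Prop :=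
  ∃ R ∈ J U, ∀ ⦃V : C⦄ (f : V ⟶ U), R f → p f

namespace Locally

variable {U : C} {p q : ∀ ⦃V : C⦄, (V ⟶ U) → Prop}

theorem of_forall (h : ∀ ⦃V : C⦄ (f : V ⟶ U), p f) : Locally J p :=
  ⟨⊤, J.top_mem U, fun _ f _ => h f⟩

theorem mono (hp : Locally J p) (h : ∀ ⦃V : C⦄ (f : V ⟶ U), p f → q f) : Locally J q :=
  let ⟨R, hR, hp⟩ := hp
  ⟨R, hR, fun _ f hf => h f (hp f hf)⟩

theorem pullback (hp : Locally J p) {V : C} (g : V ⟶ U) :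
    Locally J fun _ h => p (h ≫ g) :=
  let ⟨R, hR, hp⟩ := hp
  ⟨R.pullback g, J.pullback_stable g hR, fun _ h hh => hp (h ≫ g) hh⟩

theorem bind (hp : Locally J fun _ f => Locally J fun _ g => p (g ≫ f)) : Locally J p := by
  obtain ⟨R, hR, hp⟩ := hp
  choose S hS h using hp
  refine ⟨Sieve.bind R.arrows fun _ f hf => S f hf, J.bind_covering hR fun _ f hf => hS f hf, ?_⟩
  rintro V _ ⟨W, g, f, hf, hg, rfl⟩
  exact h f hf g hg

theorem and (hp : Locally J p) (hq : Locally J q) : Locally J fun _ f => p f ∧ q f :=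
  let ⟨R, hR, hp⟩ := hp
  let ⟨S, hS, hq⟩ := hq
  ⟨R ⊓ S, J.intersection_covering hR hS, fun _ f hf => ⟨hp f hf.1, hq f hf.2⟩⟩

theorem forall_fin {n : ℕ} {p : Fin n → ∀ ⦃V : C⦄, (V ⟶ U) → Prop}
    (hp : ∀ j, Locally J (p j)) : Locally J fun _ f => ∀ j, p j f := by
  induction n with
  | zero => exact of_forall fun _ _ j => j.elim0
  | succ n ih =>
    exact ((hp 0).and (ih fun j => hp j.succ)).mono fun _ _ h => Fin.cases h.1 h.2

theorem of_covering {R : Sieve U} (hR : R ∈ J U) : Locally J fun _ f => R f :=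
  ⟨R, hR, fun _ _ hf => hf⟩

theorem covering {R : Sieve U} (h : Locally J fun _ f => R f) : R ∈ J U :=
  let ⟨_, hS, h⟩ := h
  J.superset_covering (fun _ _ hf => h _ hf) hS

theorem mem_of_isClosed {R : Sieve U} (hR : J.IsClosed R) {V : C} {f : V ⟶ U}
    (h : Locally J fun _ g => R (g ≫ f)) : R f :=
  hR f (covering (R := R.pullback f) h)

theorem bot_mem (h : Locally J fun V (_ : V ⟶ U) => (⊥ : Sieve V) ∈ J V) : (⊥ : Sieve U) ∈ J U :=
  covering (bind (h.mono fun _ _ hf => ⟨⊥, hf, fun _ _ hg => hg.elim⟩))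

end Locally

/-! ### Local properties of terms and their order -/

section Order

variable {U : C}

theorem Tree.restrict_addNat (x : Tree J U) (k : ℕ) {V : C} (g : V ⟶ U) :
    (x.addNat k).restrict g = (x.restrict g).addNat k := by
  induction k with
  | zero => rfl
  | succ k ih => exact congrArg Tree.suc ih

theorem Tree.restrict_omegaMul (n : ℕ) {V : C} (g : V ⟶ U) :
    (Tree.omegaMul n : Tree J U).restrict g = Tree.omegaMul n := by
  induction n with
  | zero => rfl
  | succ n ih =>
    exact congrArg Tree.lim (funext fun k => by rw [Tree.restrict_addNat, ih])

theorem Tree.restrict_addNat_omegaMul (n k : ℕ) {V : C} (g : V ⟶ U) :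
    ((Tree.omegaMul n : Tree J U).addNat k).restrict g = (Tree.omegaMul n).addNat k := by
  rw [Tree.restrict_addNat, Tree.restrict_omegaMul]

theorem Le.addNat_mono {x y : Tree J U} (h : Le x y) (k : ℕ) : Le (x.addNat k) (y.addNat k) := by
  induction k with
  | zero => exact h
  | succ k ih => exact .suc_mono ih

theorem Le.suc_self {x : Tree J U} (hx : Wf x) : Le x (.suc x) := by
  induction x with
  | zero => exact .zero (.suc hx)
  | suc x ih =>
    cases hx with
    | suc h => exact .suc_mono (ih h)
  | lim f ih =>
    have hx' := hx
    cases hx with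
    | lim h _ =>
      exact .limiting hx' fun k => .trans (ih k (h k))
        (.suc_mono (.cocone k hx' (.refl (h k))))
  | glue R hR t ih =>
    have hx' := hx
    cases hx with
    | glue h h₁ h₂ =>
      refine .glue_le hx' (.suc hx') fun V f hf => .trans (ih f hf (h f hf)) (.suc_mono ?_)
      exact .le_glue (hx'.restrict f) (h f hf) fun W g hg => h₁ f hf g (g ≫ f) hg rfl

theorem Le.addNat_right {x : Tree J U} (hx : Wf x) {i j : ℕ} (h : i ≤ j) :
    Le (x.addNat i) (x.addNat j) := by
  induction h with
  | refl => exact .refl (hx.addNat i)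
  | step _ ih => exact .trans ih (.suc_self (hx.addNat _))

theorem Wf.omegaSq : Wf (.lim Tree.omegaMul : Tree J U) :=
  .lim Wf.omegaMul fun n => .cocone 1 (Wf.omegaMul (n + 1)) (.refl ((Wf.omegaMul n).addNat 1))

theorem Le.omegaMul_mono {m n : ℕ} (h : m ≤ n) :
    Le (Tree.omegaMul m : Tree J U) (Tree.omegaMul n) := by
  induction h with
  | refl => exact .refl (.omegaMul m)
  | step _ ih => exact .trans ih (.cocone 0 (Wf.omegaMul (_ + 1)) (.refl (.omegaMul _)))

theorem Le.addNat_omegaMul_mono {m n i j : ℕ} (h : m ≤ n) (h' : i ≤ j) :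
    Le ((Tree.omegaMul m : Tree J U).addNat i) ((Tree.omegaMul n).addNat j) :=
  .trans ((Le.omegaMul_mono h).addNat_mono i) (.addNat_right (.omegaMul n) h')

theorem Le.of_locally {x y : Tree J U} (hx : Wf x) (hy : Wf y)
    (h : Locally J fun _ f => Le (x.restrict f) (y.restrict f)) : Le x y := by
  obtain ⟨R, hR, h⟩ := h
  have hw : Wf (.glue R hR fun _ f _ => x.restrict f) := by
    refine .glue (fun V f _ => hx.restrict f) ?_ ?_ <;>
    · rintro V W f _ g _ _ rfl
      rw [Tree.restrict_comp]
      exact .refl (hx.restrict _)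
  exact .trans (.le_glue hw hx fun V f _ => .refl (hx.restrict f)) (.glue_le hw hy h)

/-- Where the empty sieve covers, all ordinals are equal. -/
theorem Le.of_bot_mem {x y : Tree J U} (hx : Wf x) (hy : Wf y) (h : (⊥ : Sieve U) ∈ J U) :
    Le x y :=
  .of_locally hx hy ⟨⊥, h, fun _ _ hf => hf.elim⟩

section Glue

variable {R : Sieve U} {hR : R ∈ J U} {t : ∀ ⦃V : C⦄ (f : V ⟶ U), R f → Tree J V}
  {V : C} {f : V ⟶ U}

theorem Wf.piece (hw : Wf (.glue R hR t)) (hf : R f) : Wf (t f hf) := by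
  cases hw with
  | glue h _ _ => exact h f hf

theorem Le.glue_restrict_le (hw : Wf (.glue R hR t)) (hf : R f) :
    Le ((Tree.glue R hR t).restrict f) (t f hf) := by
  have hw' := hw
  cases hw with
  | glue h h₁ h₂ =>
    exact .glue_le (hw'.restrict f) (h f hf) fun W g hg => h₂ f hf g _ hg rfl

theorem Le.le_glue_restrict (hw : Wf (.glue R hR t)) (hf : R f) :
    Le (t f hf) ((Tree.glue R hR t).restrict f) := by
  have hw' := hw
  cases hw with
  | glue h h₁ h₂ =>
    exact .le_glue (hw'.restrict f) (h f hf) fun W g hg => h₁ f hf g _ hg rfl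

end Glue

end Order

/-! ### Comparison with ordinals below `ω²` -/

/-- `OrdLE L n k` expresses `ω · n + k ≤ x` through the predicate `L n k`, meaning `ω · n + k < x`:
the former says that everything below `ω · n + k` is below `x`. -/
def OrdLE (L : ℕ → ℕ → Prop) : ℕ → ℕ → Prop
  | 0, 0 => True
  | n, k + 1 => L n k
  | n + 1, 0 => ∀ k, L n k

theorem OrdLE.mono {L L' : ℕ → ℕ → Prop} (h : ∀ n k, L n k → L' n k) :
    ∀ {n k : ℕ}, OrdLE L n k → OrdLE L' n k
  | 0, 0, _ => trivial
  | 0, k + 1, hL => h 0 k hL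
  | n + 1, k + 1, hL => h (n + 1) k hL
  | n + 1, 0, hL => fun k => h n k (hL k)

/-- The ordinal `x` at stage `U` satisfies `ω · n + k < x` at the later stage `g : V ⟶ U`.  The
recursion is on `x` alone and makes no use of well-formedness. -/
def Tree.Lt : ∀ {U : C}, Tree J U → ℕ → ℕ → ∀ {V : C}, (V ⟶ U) → Prop
  | _, .zero, _, _, V, _ => (⊥ : Sieve V) ∈ J V
  | _, .suc x, n, k, _, g => OrdLE (fun n k => x.Lt n k g) n k
  | _, .lim f, n, k, _, g => Locally J fun _ h => ∃ m, (f m).Lt n k (h ≫ g)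
  | _, .glue R _ t, n, k, _, g =>
    Locally J fun W h => ∃ hR : R (h ≫ g), (t (h ≫ g) hR).Lt n k (𝟙 W)

namespace Tree.Lt

theorem comp {U : C} {x : Tree J U} {n k : ℕ} {V W : C} {g : V ⟶ U} (hx : x.Lt n k g)
    (h : W ⟶ V) : x.Lt n k (h ≫ g) := by
  induction x generalizing n k V W with
  | zero => exact J.superset_covering (fun _ _ h => h) (J.pullback_stable h hx)
  | suc x ih => exact OrdLE.mono (fun _ _ hL => ih hL h) hx
  | lim f ih =>
    refine (Locally.pullback hx h).mono fun _ g' ⟨m, hm⟩ => ⟨m, ?_⟩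
    rwa [Category.assoc] at hm
  | glue R hR t ih =>
    refine (Locally.pullback hx h).mono fun _ g' hm => ?_
    rwa [Category.assoc] at hm

theorem of_locally {U : C} {x : Tree J U} {n k : ℕ} {V : C} {g : V ⟶ U}
    (hx : Locally J fun _ h => x.Lt n k (h ≫ g)) : x.Lt n k g := by
  induction x generalizing n k V with
  | zero => exact Locally.bot_mem hx
  | suc x ih =>
    match n, k with
    | 0, 0 => trivial
    | 0, k + 1 => exact ih hx
    | n + 1, k + 1 => exact ih hx
    | n + 1, 0 => exact fun k => ih (hx.mono fun _ _ h => h k)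
  | lim f ih =>
    refine Locally.bind (hx.mono fun _ h hh => hh.mono fun _ g' hm => ?_)
    rwa [Category.assoc]
  | glue R hR t ih =>
    refine Locally.bind (hx.mono fun _ h hh => hh.mono fun _ g' hm => ?_)
    rwa [Category.assoc]

end Tree.Lt

theorem Tree.lt_restrict {U : C} {x : Tree J U} {n k : ℕ} {V W : C} {g : V ⟶ U} {h : W ⟶ V} :
    (x.restrict g).Lt n k h ↔ x.Lt n k (h ≫ g) := by
  induction x generalizing n k V W with
  | zero => exact Iff.rfl
  | suc x ih => exact ⟨OrdLE.mono fun _ _ => ih.1, OrdLE.mono fun _ _ => ih.2⟩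
  | lim f ih =>
    refine ⟨fun H => H.mono fun _ l ⟨m, hm⟩ => ⟨m, ?_⟩, fun H => H.mono fun _ l ⟨m, hm⟩ => ⟨m, ?_⟩⟩
    · rwa [ih, Category.assoc] at hm
    · rwa [ih, Category.assoc]
  | glue R hR t ih =>
    refine ⟨fun H => H.mono fun _ l hm => ?_, fun H => H.mono fun _ l hm => ?_⟩
    · obtain ⟨hR, hm⟩ := hm
      have e := Category.assoc l h g
      exact ⟨e ▸ hR, Tree.piece_congr t e hR (e ▸ hR) ▸ hm⟩
    · obtain ⟨hR, hm⟩ := hm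
      have e := (Category.assoc l h g).symm
      have hR' : R ((l ≫ h) ≫ g) := e ▸ hR
      rw [Tree.piece_congr t e hR hR'] at hm
      exact ⟨hR', hm⟩

theorem Le.lt_of_lt : ∀ {U : C} {x y : Tree J U}, Le x y → ∀ {n k : ℕ} {V : C} {g : V ⟶ U},
    x.Lt n k g → y.Lt n k g
  | _, _, _, .zero _, _, _, _, _, h => .of_locally ⟨⊥, h, fun _ _ hf => hf.elim⟩
  | _, _, _, .trans h₁ h₂, _, _, _, _, h => Le.lt_of_lt h₂ (Le.lt_of_lt h₁ h)
  | _, _, _, .suc_mono h₁, _, _, _, _, h => OrdLE.mono (fun _ _ hL => Le.lt_of_lt h₁ hL) h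
  | _, _, _, .cocone m _ h₁, _, _, _, _, h =>
    Locally.of_forall fun _ l => ⟨m, (Le.lt_of_lt h₁ h).comp l⟩
  | _, _, _, .limiting _ h₁, _, _, _, _, h =>
    .of_locally (h.mono fun _ _ ⟨m, hm⟩ => Le.lt_of_lt (h₁ m) hm)
  | _, _, _, .glue_le _ _ h₁, _, _, _, _, h =>
    .of_locally (h.mono fun _ _ ⟨hR, hm⟩ => by
      simpa using Tree.lt_restrict.1 (Le.lt_of_lt (h₁ _ hR) hm))
  | _, _, _, .le_glue (hR := hR) _ _ h₁, _, _, _, g, h =>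
    ⟨_, J.pullback_stable g hR, fun _ l hl => ⟨hl, Le.lt_of_lt (h₁ _ hl) <|
      Tree.lt_restrict.2 (by simpa using h.comp l)⟩⟩

/-- `ω · n + k ≤ ω · n + k`, with the left-hand side understood through `Tree.Lt`. -/
theorem ordLE_addNat_omegaMul {U : C} (n k : ℕ) {V : C} (g : V ⟶ U) :
    OrdLE (fun n' k' => ((Tree.omegaMul n : Tree J U).addNat k).Lt n' k' g) n k := by
  induction n generalizing k V with
  | zero => cases k with
    | zero => trivial
    | succ k =>
      induction k with
      | zero => trivial
      | succ k ih => exact ih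
  | succ n ihn =>
    cases k with
    | zero => exact fun k => Locally.of_forall fun _ h => ⟨k + 1, by
        have := ihn k (h ≫ g)
        cases n <;> exact this⟩
    | succ k =>
      induction k with
      | zero => exact fun k => Locally.of_forall fun _ h => ⟨k + 1, by
          have := ihn k (h ≫ g)
          cases n <;> exact this⟩
      | succ k ih => exact ih

theorem Tree.lt_omegaSq {U : C} (n : ℕ) {V : C} (g : V ⟶ U) :
    (Tree.lim Tree.omegaMul : Tree J U).Lt n 0 g := by
  refine Locally.of_forall fun _ h => ⟨n + 1, Locally.of_forall fun _ l => ⟨1, ?_⟩⟩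
  have := ordLE_addNat_omegaMul (J := J) n 0 (l ≫ h ≫ g)
  cases n <;> exact this

/-- A limit ordinal `ω · (n + 1)` below `x + m` is already below `x`. -/
theorem Tree.forall_lt_of_addNat {U : C} {x : Tree J U} {m n : ℕ} {V : C} {g : V ⟶ U}
    (h : ∀ k, (x.addNat m).Lt n k g) (k : ℕ) : x.Lt n k g := by
  induction m generalizing k with
  | zero => exact h k
  | succ m ih =>
    refine ih (fun k => ?_) k
    have := h (k + 1)
    cases n <;> exact this

namespace Tree.Lt

theorem le_of_addNat_omegaMul {U : C} {c i k : ℕ} {V : C} {g : V ⟶ U}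
    (h : ((Tree.omegaMul c : Tree J U).addNat i).Lt k 0 g) : k ≤ c ∨ (⊥ : Sieve V) ∈ J V := by
  -- The strict bound at `i = 0` is what passes through the limit `ω · (c + 1)`.
  have key : ∀ c : ℕ, (∀ {k : ℕ} {V : C} {g : V ⟶ U},
        (Tree.omegaMul c : Tree J U).Lt k 0 g → k < c ∨ (⊥ : Sieve V) ∈ J V) →
      ∀ {i k : ℕ} {V : C} {g : V ⟶ U}, ((Tree.omegaMul c : Tree J U).addNat i).Lt k 0 g →
        k ≤ c ∨ (⊥ : Sieve V) ∈ J V := by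
    intro c hc i k V g h
    cases i with
    | zero => exact (hc h).imp_left le_of_lt
    | succ i =>
      cases k with
      | zero => exact .inl c.zero_le
      | succ k => exact hc (Tree.forall_lt_of_addNat h 0)
  refine key c ?_ h
  clear h
  induction c with
  | zero => exact fun h => .inr h
  | succ c ih =>
    intro k V g h
    by_cases hk : k ≤ c
    · exact .inl (Nat.lt_succ_of_le hk)
    · exact .inr (Locally.bot_mem (h.mono fun _ l ⟨m, hm⟩ => (key c ih hm).resolve_left hk))

end Tree.Lt

/-! ### Suprema of the ordinals `ω · k + i` over the initial segments that hold -/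

/-- The proposition `P` at a later stage. -/
def Truth.restrict {U V : C} (P : Truth J U) (f : V ⟶ U) : Truth J V :=
  ⟨P.1.pullback f, J.isClosed_pullback f P.1 P.2⟩

/-- `x` is the supremum, at all stages after `U`, of the ordinals `ω · k + i` with `k ≤ n` for which
`P 0, …, P (k - 1)` hold.  The last field says that this supremum exceeds `ω · k` only if
`P 0, …, P (k - 1)` hold. -/
structure IsCountSup {U : C} (P : ℕ → Truth J U) (n : ℕ) (x : Tree J U) : Prop where
  wf : Wf x
  le : ∀ ⦃k : ℕ⦄, k ≤ n → ∀ ⦃V : C⦄ (g : V ⟶ U), (∀ j < k, (P j).1 g) →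
    ∀ i, Le ((Tree.omegaMul k).addNat i) (x.restrict g)
  least : ∀ ⦃V : C⦄ (g : V ⟶ U) (y : Tree J V), Wf y →
    (∀ k ≤ n, ∀ ⦃W : C⦄ (h : W ⟶ V), (∀ j < k, (P j).1 (h ≫ g)) →
      ∀ i, Le ((Tree.omegaMul k).addNat i) (y.restrict h)) → Le (x.restrict g) y
  holds_of_lt : ∀ ⦃k : ℕ⦄ ⦃V : C⦄ (g : V ⟶ U), x.Lt k 0 g → ∀ j < k, (P j).1 g

theorem IsCountSup.restrict_le_restrict {U V₁ V₂ W : C} {P : ℕ → Truth J U} {m n : ℕ} {f₁ : V₁ ⟶ U}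
    {f₂ : V₂ ⟶ U} {x : Tree J V₁} {y : Tree J V₂}
    (hx : IsCountSup (fun j => (P j).restrict f₁) m x)
    (hy : IsCountSup (fun j => (P j).restrict f₂) n y) (hmn : m ≤ n) {g₁ : W ⟶ V₁} {g₂ : W ⟶ V₂}
    (h : g₁ ≫ f₁ = g₂ ≫ f₂) : Le (x.restrict g₁) (y.restrict g₂) := by
  refine hx.least g₁ _ (hy.wf.restrict g₂) fun k hk W' l hl i => ?_
  rw [Tree.restrict_comp]
  refine hy.le (hk.trans hmn) (l ≫ g₂) (fun j hj => ?_) i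
  have := hl j hj
  simp only [Truth.restrict, Sieve.pullback_apply, Category.assoc, h] at this ⊢
  exact this

/-- Suprema that exist locally can be amalgamated, as they are unique. -/
theorem exists_isCountSup_of_locally {U : C} {P : ℕ → Truth J U} {n : ℕ}
    (h : Locally J fun _ f => ∃ x, IsCountSup (fun j => (P j).restrict f) n x) :
    ∃ x, IsCountSup P n x := by
  obtain ⟨R, hR, h⟩ := h
  choose t ht using h
  have hw : Wf (.glue R hR t) := by
    refine .glue (fun V f hf => (ht f hf).wf) ?_ ?_ <;>
    · rintro V W f hf g k hk rfl
      rw [← Tree.restrict_id (t (g ≫ f) hk)]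
      exact (ht _ _).restrict_le_restrict (ht _ _) le_rfl (by simp)
  refine ⟨_, hw, fun k hk V g hg i => ?_, fun V g y hy H => ?_, fun k V g hg j hj => ?_⟩
  · refine .of_locally ((Wf.omegaMul k).addNat i) (hw.restrict g)
      ⟨_, J.pullback_stable g hR, fun W l hl => ?_⟩
    beta_reduce
    rw [Tree.restrict_addNat_omegaMul, Tree.restrict_comp]
    refine .trans ?_ (Le.le_glue_restrict hw hl)
    rw [← Tree.restrict_id (t _ hl)]
    exact (ht _ hl).le hk (𝟙 W) (fun j hj => by
      simpa [Truth.restrict] using (P j).1.downward_closed (hg j hj) l) i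
  · refine .of_locally (hw.restrict g) hy ⟨_, J.pullback_stable g hR, fun W l hl => ?_⟩
    beta_reduce
    rw [Tree.restrict_comp]
    refine .trans (Le.glue_restrict_le hw hl) ?_
    rw [← Tree.restrict_id (t _ hl)]
    refine (ht _ hl).least (𝟙 W) _ (hy.restrict l) fun k hk W' l' hl' i => ?_
    rw [Tree.restrict_comp]
    exact H k hk (l' ≫ l) (fun j hj => by simpa [Truth.restrict] using hl' j hj) i
  · exact Locally.mem_of_isClosed (P j).2 (Locally.mono hg fun W l ⟨hl, hlt⟩ => by
      simpa [Truth.restrict] using (ht _ hl).holds_of_lt (𝟙 W) hlt j hj)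

/-! ### The supremum computed from Boolean sequences -/

section Approx

variable {U : C} {n : ℕ} (s : Fin n → ℕ → BoolSection J U)

/-- The stages at which all values of the sequences up to the index `i` are decided. -/
def decidedSieve (i : ℕ) : Sieve U where
  arrows _ f := ∀ j, ∀ i' ≤ i, ∃ b, ((s j i').holds b) f
  downward_closed h g j i' hi' :=
    let ⟨b, hb⟩ := h j i' hi'
    ⟨b, ((s j i').holds b).downward_closed hb g⟩

theorem decidedSieve_mem (i : ℕ) : decidedSieve s i ∈ J U := by
  have h : Locally J fun V (f : V ⟶ U) => ∀ j, ∀ i' : Fin (i + 1), ∃ b, ((s j i').holds b) f :=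
    Locally.forall_fin fun j => Locally.forall_fin fun i' =>
      (Locally.of_covering (s j i').covers).mono fun V f hf => by
        rcases hf with hf | hf
        · exact ⟨_, hf⟩
        · exact ⟨_, hf⟩
  exact Locally.covering (h.mono fun V f hf j i' hi' => hf j ⟨i', Nat.lt_succ_of_le hi'⟩)

open Classical in
/-- The largest `k ≤ n` such that each of the first `k` sequences takes the value `true` at an index
up to `i`, judged by the values known at `f`. -/
noncomputable def count (i : ℕ) {V : C} (f : V ⟶ U) : ℕ :=
  Nat.findGreatest (fun k => ∀ j : Fin n, j.1 < k → ∃ i' ≤ i, ((s j i').holds true) f) n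

variable {s} {i : ℕ} {V W : C} {f : V ⟶ U}

theorem count_le : count s i f ≤ n := by
  classical
  exact Nat.findGreatest_le n

theorem exists_holds_of_lt_count {j : Fin n} (hj : j.1 < count s i f) :
    ∃ i' ≤ i, ((s j i').holds true) f := by
  classical
  exact Nat.findGreatest_spec
    (P := fun k => ∀ j : Fin n, j.1 < k → ∃ i' ≤ i, ((s j i').holds true) f)
    n.zero_le (fun _ h => absurd h (Nat.not_lt_zero _)) j hj

theorem le_count {k : ℕ} (hk : k ≤ n)
    (h : ∀ j : Fin n, j.1 < k → ∃ i' ≤ i, ((s j i').holds true) f) : k ≤ count s i f := by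
  classical
  exact Nat.le_findGreatest hk h

theorem count_le_count_comp {i' : ℕ} (hi : i ≤ i') (g : W ⟶ V) :
    count s i f ≤ count s i' (g ≫ f) :=
  le_count count_le fun j hj =>
    let ⟨l, hl, hl'⟩ := exists_holds_of_lt_count hj
    ⟨l, hl.trans hi, ((s j l).holds true).downward_closed hl' g⟩

/-- At decided stages the count does not grow under restriction, unless the stage is void. -/
theorem count_comp_le (hf : decidedSieve s i f) (g : W ⟶ V) :
    count s i (g ≫ f) ≤ count s i f ∨ (⊥ : Sieve W) ∈ J W := by
  by_contra! hcon
  refine hcon.1.not_ge (le_count count_le fun j hj => ?_)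
  obtain ⟨l, hl, hl'⟩ := exists_holds_of_lt_count hj
  obtain ⟨b, hb⟩ := hf j l hl
  cases b with
  | true => exact ⟨l, hl, hb⟩
  | false =>
    exact absurd ((s j l).disjoint _ hl' (((s j l).holds false).downward_closed hb g)) hcon.2

variable (s i) in
/-- The ordinal `ω · c + i`, where `c` is the locally constant number `count s i`. -/
noncomputable def approx : Tree J U :=
  .glue (decidedSieve s i) (decidedSieve_mem s i) fun _ f _ =>
    (Tree.omegaMul (count s i f)).addNat i

variable (s i) in
theorem Wf.approx : Wf (approx s i) := by
  refine .glue (fun V f _ => (Wf.omegaMul _).addNat i) ?_ ?_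
  · rintro V W f hf g _ - rfl
    rw [Tree.restrict_addNat_omegaMul]
    exact .addNat_omegaMul_mono (count_le_count_comp le_rfl g) le_rfl
  · rintro V W f hf g _ - rfl
    rw [Tree.restrict_addNat_omegaMul]
    rcases count_comp_le hf g with h | h
    · exact .addNat_omegaMul_mono h le_rfl
    · exact .of_bot_mem ((Wf.omegaMul _).addNat i) ((Wf.omegaMul _).addNat i) h

variable (s) in
theorem Wf.lim_approx : Wf (.lim (OrdDec.approx s)) := by
  refine .lim (fun i => .approx s i) fun i =>
    .of_locally (.suc (.approx s i)) (.approx s (i + 1)) <|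
      ((Locally.of_covering (decidedSieve_mem s i)).and
        (Locally.of_covering (decidedSieve_mem s (i + 1)))).mono fun V f ⟨h₁, h₂⟩ => ?_
  refine .trans (.suc_mono (Le.glue_restrict_le (.approx s i) h₁)) <|
    .trans (.suc_mono ?_) (Le.le_glue_restrict (.approx s (i + 1)) h₂)
  simpa using Le.addNat_omegaMul_mono (J := J)
    (count_le_count_comp (s := s) (f := f) i.le_succ (𝟙 V)) le_rfl

theorem isCountSup_lim_approx {P : ℕ → Truth J U}
    (hs : ∀ j : Fin n, ∀ ⦃V : C⦄ (g : V ⟶ U), (P j).1 g ↔ ExistsTrue (s j) g) :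
    IsCountSup P n (.lim (approx s)) := by
  refine ⟨.lim_approx s, fun k hk V g hg i => ?_, fun V g y hy H => ?_, fun k V g hg j hj => ?_⟩
  · have h : Locally J fun _ l => ∀ j : Fin n, j.1 < k → ∃ i, ((s j i).holds true) (l ≫ g) := by
      refine Locally.forall_fin fun j => ?_
      by_cases hj : j.1 < k
      · exact Locally.mono ((hs j g).1 (hg j hj)) fun _ _ h _ => h
      · exact Locally.of_forall fun _ _ h => absurd h hj
    refine .of_locally ((Wf.omegaMul k).addNat i) ((Wf.lim_approx s).restrict g)
      (Locally.bind (h.mono fun V' l hl => ?_))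
    choose! a ha using hl
    -- From the index `b` on, the first `k` sequences have all reached the value `true`.
    let b := max i (Finset.univ.sup a)
    refine ⟨_, J.pullback_stable (l ≫ g) (decidedSieve_mem s b), fun W e he => ?_⟩
    beta_reduce
    rw [Tree.restrict_addNat_omegaMul, Tree.restrict_comp, Category.assoc]
    refine .cocone b ((Wf.lim_approx s).restrict _) <|
      .trans ?_ (Le.le_glue_restrict (.approx s b) he)
    exact .addNat_omegaMul_mono (le_count hk fun j hj =>
      ⟨a j, le_max_of_le_right (Finset.le_sup (Finset.mem_univ j)),
        ((s j (a j)).holds true).downward_closed (ha j hj) e⟩) (le_max_left _ _)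
  · refine .limiting ((Wf.lim_approx s).restrict g) fun i => .of_locally
      ((Wf.approx s i).restrict g) hy
      ⟨_, J.pullback_stable g (decidedSieve_mem s i), fun W l hl => ?_⟩
    beta_reduce
    rw [Tree.restrict_comp]
    refine .trans (Le.glue_restrict_le (.approx s i) hl) ?_
    refine H _ count_le l (fun j hj => ?_) i
    have hjn : j < n := hj.trans_le count_le
    obtain ⟨i', -, hi'⟩ := exists_holds_of_lt_count (j := ⟨j, hjn⟩) hj
    exact (hs ⟨j, hjn⟩ (l ≫ g)).2 (Locally.of_forall fun _ e =>
      ⟨i', ((s _ i').holds true).downward_closed hi' e⟩)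
  · refine Locally.mem_of_isClosed (P j).2 (Locally.bind (Locally.mono hg fun W l ⟨i, hi⟩ =>
      Locally.mono hi fun W' e ⟨_, he⟩ => ?_))
    rw [Category.assoc]
    rcases he.le_of_addNat_omegaMul with h | h
    · have hj' := hj.trans_le h
      have hjn : j < n := hj'.trans_le count_le
      obtain ⟨i', -, hi'⟩ := exists_holds_of_lt_count (j := ⟨j, hjn⟩) hj'
      exact (hs ⟨j, hjn⟩ _).2 (Locally.of_forall fun _ e =>
        ⟨i', ((s _ i').holds true).downward_closed hi' e⟩)
    · exact Locally.mem_of_isClosed (P j).2 ⟨⊥, h, fun _ _ hf => hf.elim⟩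

end Approx

theorem exists_isCountSup {U : C} {P : ℕ → Truth J U} (hP : ∀ n, IsSemidecidable (P n)) (n : ℕ) :
    ∃ x, IsCountSup P n x := by
  have h : Locally J fun V (f : V ⟶ U) => ∀ j : Fin n, ∃ s : ℕ → BoolSection J V,
      ∀ ⦃W : C⦄ (g : W ⟶ V), (P j).1 (g ≫ f) ↔ ExistsTrue s g :=
    Locally.forall_fin fun j => hP j
  refine exists_isCountSup_of_locally (h.mono fun V f hf => ?_)
  choose s hs using hf
  exact ⟨_, isCountSup_lim_approx (s := s) hs⟩

end OrdDec

/-- In the internal logic of every Grothendieck topos: if `P : ℕ → Prop` is a family of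
semidecidable propositions, then `∀ n, P n` is `ω²`-decidable.  (The family is given at an arbitrary
stage `U` of an arbitrary site.) -/
theorem theorem7p5 {C : Type u} [CategoryTheory.Category.{v} C]
    (J : CategoryTheory.GrothendieckTopology C) (U : C)
    (P : ℕ → OrdDec.Truth J U) (hP : ∀ n, OrdDec.IsSemidecidable (P n)) :
    OrdDec.IsOrdinalDecidable (OrdDec.Brw.omegaSq U) (OrdDec.Truth.forallNat P) := by
  obtain ⟨x, hx⟩ := Classical.skolem.1 (OrdDec.exists_isCountSup hP)
  have hmono : ∀ n, OrdDec.Le (x n) (x (n + 1)) := fun n => by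
    rw [← OrdDec.Tree.restrict_id (x n)]
    refine (hx n).least (𝟙 U) _ (hx (n + 1)).wf fun k hk V g hg => ?_
    exact (hx (n + 1)).le (hk.trans n.le_succ) g (by simpa using hg)
  -- The summand `n + 1` makes the sequence strictly increasing, and every member a successor.
  have hw : OrdDec.Wf (.lim fun n => (x n).addNat (n + 1)) :=
    .lim (fun n => (hx n).wf.addNat (n + 1)) fun n => (hmono n).addNat_mono (n + 2)
  refine ⟨⊤, J.top_mem U, fun V f _ => ⟨.restrict f (Quotient.mk _ ⟨_, hw⟩), fun W g => ?_⟩⟩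
  change (∀ n, (P n).1 (g ≫ f)) ↔
    OrdDec.Le ((OrdDec.Tree.lim OrdDec.Tree.omegaMul).restrict (g ≫ f))
      (((OrdDec.Tree.lim fun n => (x n).addNat (n + 1)).restrict f).restrict g)
  rw [OrdDec.Tree.restrict_comp _ f g]
  constructor
  · intro h
    refine .limiting (OrdDec.Wf.omegaSq.restrict (g ≫ f)) fun n =>
      .cocone n (hw.restrict (g ≫ f)) ?_
    rw [OrdDec.Tree.restrict_omegaMul, OrdDec.Tree.restrict_addNat]
    exact .trans ((hx n).le le_rfl (g ≫ f) (fun j _ => h j) 0)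
      (.addNat_right ((hx n).wf.restrict _) (n + 1).zero_le)
  · intro h n
    have hlt := OrdDec.Tree.lt_restrict.1
      (h.lt_of_lt (OrdDec.Tree.lt_restrict.2 (OrdDec.Tree.lt_omegaSq (n + 2) (𝟙 W ≫ g ≫ f))))
    rw [Category.id_comp] at hlt
    refine OrdDec.Locally.mem_of_isClosed (P n).2 (hlt.mono fun _ l ⟨m, hm⟩ => ?_)
    exact (hx m).holds_of_lt _ (OrdDec.Tree.forall_lt_of_addNat (m := m) hm 0) n n.lt_succ_self
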